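/- **Setting.** Let $L^2=L^2(\mathbb R)$ be the complex Hilbert space for Lebesgue measure. For $k\in\mathbb N$ and a Banach space $B$, let $C(\mathbb R^k,B)$ be the Banach space, with the supremum norm, of continuous functions $\mathbb R^k\to B$ vanishing at infinity. A *$K^0$-kernel* is a function $\boldsymbol T\in C(\mathbb R^2,\mathbb C)$ whose *Carleman functions* $\boldsymbol t(s)=\overline{\boldsymbol T(s,\cdot)}$ and $\boldsymbol t'(s)=\boldsymbol T(\cdot,s)$ are defined for every $s\in\mathbb R$ and belong to $C(\mathbb R,L^2)$. For a bounded operator $S$ on $L^2$ let $\Pi(S)$ be the set of $\lambda\in\mathbb C$ such that $I-\lambda S$ has a bounded inverse, and for $\lambda\in\Pi(S)$ put $S_{|\lambda}=S(I-\lambda S)^{-1}$. For a sequence $\{S_n\}$ of bounded operators, $\nabla_b(\{S_n\})$ is the set of nonzero $\zeta\in\mathbb C$ for which there are positive constants $M,N$ with $\zeta\in\Pi(S_n)$ and $\|S_{n|\zeta}\|\le M$ for all $n>N$; and $\nabla_s(\{S_n\})$ is the set of $\zeta\in\nabla_b(\{S_n\})$ for which $\lim_n S_{n|\zeta}f$ exists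 in $L^2$ for every $f\in L^2$. A *resolvent kernel* for a $K^0$-kernel $\boldsymbol T$ at $\lambda\in\mathbb C$ is a $K^0$-kernel $\boldsymbol T_{|\lambda}$ such that, for all $s,t\in\mathbb R$, $$\boldsymbol T_{|\lambda}(s,t)-\lambda\int\boldsymbol T(s,x)\boldsymbol T_{|\lambda}(x,t)\,dx=\boldsymbol T(s,t)=\boldsymbol T_{|\lambda}(s,t)-\lambda\int\boldsymbol T_{|\lambda}(s,x)\boldsymbol T(x,t)\,dx,$$ and $\int\bigl|\int\boldsymbol T_{|\lambda}(s,t)f(t)\,dt\bigr|^2ds<\infty$ for all $f\in L^2$. Its Carleman functions $\boldsymbol t_{|\lambda},\boldsymbol t'_{|\lambda}$ are the *resolvent Carleman functions* for $\boldsymbol T$ at $\lambda$. **Hypotheses.** Let $\boldsymbol T$ be a $K^0$-kernel that induces a bounded integral operator $T$ on $L^2$, $(Tf)(s)=\int\boldsymbol T(s,t)f(t)\,dt$ for almost every $s$. Assume that there are positive reals $\tau_n$ ($n\in\mathbb N$), strictly increasing to $+\infty$, such that, with $\chi_n$ the characteristic function of $(-\tau_n,\tau_n)$ and $P_nf=\chi_nf$,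 for each $n$ the subkernels $\boldsymbol T_n(s,t)=\chi_n(s)\boldsymbol T(s,t)$ and $\widetilde{\boldsymbol T}_n(s,t)=\chi_n(s)\boldsymbol T(s,t)\chi_n(t)$ are $K^0$-kernels and the integral operators $T_n=P_nT$ and $\widetilde T_n=P_nTP_n$ they induce are nuclear (compact, with $\sum_k|\langle Au_k,u_k\rangle|<\infty$ for every orthonormal basis $\{u_k\}$ of $L^2$, $A$ being the operator in question). Let $\{\beta_n\}$ be an arbitrary complex sequence with $\beta_n\to0$ and put $\lambda_n(\lambda)=\lambda(1-\beta_n\lambda)^{-1}$; for each fixed $\lambda\in\mathbb C$ this is defined for all large $n$ and tends to $\lambda$. Write $\boldsymbol T_{n|\lambda}$, $\boldsymbol t_{n|\lambda}$, $\boldsymbol t'_{n|\lambda}$ for the resolvent kernel and resolvent Carleman functions for $\boldsymbol T_n$ at $\lambda$. **Theorem.** One has $$\varnothing\ne\nabla_s(\{\beta_nI+T_n\})\subseteq\nabla_s(\{\beta_nI+\widetilde T_n\})\subseteq\Pi(T).$$ For $\lambda\in\nabla_s(\{\beta_nI+\widetilde T_n\})$ the resolvent kernel $\boldsymbol T_{|\lambda}$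 exists and is unique; and for every compact $\widetilde{\mathfrak K}\subseteq\nabla_s(\{\beta_nI+\widetilde T_n\})$ there is an $N$ such that for all $n>N$ and all $\lambda\in\widetilde{\mathfrak K}$ the number $\lambda_n(\lambda)$ is defined and the resolvent kernel $\boldsymbol T_{n|\lambda_n(\lambda)}$ exists and is unique. Moreover: (a) $\lim_n\|\boldsymbol t'_{n|\lambda_n(\lambda)}-\boldsymbol t'_{|\lambda}\|_{C(\mathbb R,L^2)}=0$ for each fixed $\lambda\in\nabla_s(\{\beta_nI+\widetilde T_n\})$, and $\lim_n\sup_{\lambda\in\widetilde{\mathfrak K}}\|\boldsymbol t'_{n|\lambda_n(\lambda)}(t)-\boldsymbol t'_{|\lambda}(t)\|=0$ for each fixed $t\in\mathbb R$ and each compact $\widetilde{\mathfrak K}\subseteq\nabla_s(\{\beta_nI+\widetilde T_n\})$; (b) $\lim_n\|\boldsymbol t_{n|\lambda_n(\lambda)}-\boldsymbol t_{|\lambda}\|_{C(\mathbb R,L^2)}=0$ for each fixed $\lambda\in\nabla_s(\{\beta_nI+T_n\})$, and $\lim_n\sup_{\lambda\in\mathfrak K}\|\boldsymbol t_{n|\lambda_n(\lambda)}(s)-\boldsymbol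 t_{|\lambda}(s)\|=0$ for each fixed $s\in\mathbb R$ and each compact $\mathfrak K\subseteq\nabla_s(\{\beta_nI+T_n\})$; (c) $\lim_n\|\boldsymbol T_{n|\lambda_n(\lambda)}-\boldsymbol T_{|\lambda}\|_{C(\mathbb R^2,\mathbb C)}=0$ for each fixed $\lambda\in\nabla_s(\{\beta_nI+\widetilde T_n\})$, and $\lim_n\sup_{\lambda\in\widetilde{\mathfrak K}}|\boldsymbol T_{n|\lambda_n(\lambda)}(s,t)-\boldsymbol T_{|\lambda}(s,t)|=0$ for each fixed $(s,t)\in\mathbb R^2$ and each compact $\widetilde{\mathfrak K}\subseteq\nabla_s(\{\beta_nI+\widetilde T_n\})$. -/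

import Mathlib

open MeasureTheory Filter Topology
open scoped ZeroAtInfty ComplexConjugate InnerProductSpace

noncomputable section

/-- The complex Hilbert space `L²(ℝ)` with respect to Lebesgue measure. -/
abbrev L2 : Type := Lp ℂ 2 (volume : Measure ℝ)

/-! ### Operators on `L²` -/

/-- `Π(T)`: the set of regular values of `T`, i.e. all `z` such that `I - z T` is invertible in the
algebra of bounded operators on `L²`. -/
def regularValues (T : L2 →L[ℂ] L2) : Set ℂ :=
  {z | IsUnit (1 - z • T)}

/-- The Fredholm resolvent `T (I - z T)⁻¹`, meaningful for `z ∈ Π(T)`. -/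
def fredholmResolvent (T : L2 →L[ℂ] L2) (z : ℂ) : L2 →L[ℂ] L2 :=
  T * Ring.inverse (1 - z • T)

/-- `∇_b({S_n})`: nonzero `ζ` such that, from some index on, `ζ` is a regular value of `S_n` and the
Fredholm resolvents of `S_n` at `ζ` are bounded in norm by one constant. -/
def nablaB (S : ℕ → L2 →L[ℂ] L2) : Set ℂ :=
  {ζ | ζ ≠ 0 ∧ ∃ M : ℝ, 0 < M ∧ ∃ N : ℕ, ∀ n > N,
    ζ ∈ regularValues (S n) ∧ ‖fredholmResolvent (S n) ζ‖ ≤ M}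

/-- `∇_s({S_n})`: those `ζ` in `∇_b({S_n})` for which the Fredholm resolvents of `S_n` at `ζ`
converge in the strong operator topology. -/
def nablaS (S : ℕ → L2 →L[ℂ] L2) : Set ℂ :=
  {ζ | ζ ∈ nablaB S ∧
    ∀ f : L2, ∃ g : L2, Tendsto (fun n => fredholmResolvent (S n) ζ f) atTop (𝓝 g)}

/-- A nuclear operator on `L²`: a compact operator `A` with `∑ |⟨A u_n, u_n⟩| < ∞` for every
orthonormal basis `{u_n}` of the separable, infinite-dimensional space `L²`. -/
def IsNuclear (A : L2 →L[ℂ] L2) : Prop :=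
  IsCompactOperator A ∧ ∀ u : HilbertBasis ℕ ℂ L2, Summable fun n => ‖⟪A (u n), u n⟫_ℂ‖

/-- The characteristic function of the open interval `(-a, a)`. -/
def chi (a : ℝ) : ℝ → ℂ :=
  (Set.Ioo (-a) a).indicator 1

lemma memLp_chi_mul (a : ℝ) (f : L2) : MemLp (fun s => chi a s * f s) 2 volume := by
  have h := (Lp.memLp f).indicator (measurableSet_Ioo (a := -a) (b := a))
  have e : (fun s => chi a s * f s) = (Set.Ioo (-a) a).indicator f := by
    funext s
    by_cases hs : s ∈ Set.Ioo (-a) a <;> simp [chi, hs]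
  rw [e]
  exact h

/-- The orthogonal projection of `L²` given by multiplication by the characteristic function of
`(-a, a)`. -/
def cutoff (a : ℝ) : L2 →L[ℂ] L2 :=
  LinearMap.mkContinuous
    { toFun := fun f => (memLp_chi_mul a f).toLp _
      map_add' := by
        intro f g
        rw [← MemLp.toLp_add]
        apply MemLp.toLp_congr
        filter_upwards [Lp.coeFn_add f g] with s hs
        rw [hs]
        exact mul_add _ _ _
      map_smul' := by
        intro c f
        rw [RingHom.id_apply, ← MemLp.toLp_const_smul]
        apply MemLp.toLp_congr
        filter_upwards [Lp.coeFn_smul c f] with s hs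
        rw [hs]
        exact mul_left_comm _ _ _ }
    1 (by
      intro f
      rw [one_mul]
      apply Lp.norm_le_norm_of_ae_le
      filter_upwards [(memLp_chi_mul a f).coeFn_toLp] with s hs
      simp only [LinearMap.coe_mk, AddHom.coe_mk]
      rw [hs]
      by_cases h : s ∈ Set.Ioo (-a) a <;> simp [chi, h])

lemma cutoff_coeFn (a : ℝ) (f : L2) : cutoff a f =ᵐ[volume] fun s => chi a s * f s :=
  (memLp_chi_mul a f).coeFn_toLp

/-! ### `K⁰`-kernels -/

/-- A `K⁰`-kernel: a function `kern` on `ℝ²`, continuous and vanishing at infinity, whose two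
Carleman functions `t s = conj (kern (s, ·))` and `t' s = kern (·, s)` are everywhere defined
with values in `L²`, continuous, and vanishing at infinity. The fields `t` and `t'` are determined
by `kern`. The spaces `C₀(X, B)` carry the supremum norm. -/
structure K0Kernel where
  kern : C₀(ℝ × ℝ, ℂ)
  t : C₀(ℝ, L2)
  t' : C₀(ℝ, L2)
  t_coeFn : ∀ s : ℝ, t s =ᵐ[volume] fun x => conj (kern (s, x))
  t'_coeFn : ∀ s : ℝ, t' s =ᵐ[volume] fun x => kern (x, s)

/-- A `K⁰`-kernel is determined by its values as a function on `ℝ²`. -/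
theorem K0Kernel.ext_kern {K L : K0Kernel} (h : K.kern = L.kern) : K = L := by
  obtain ⟨k, t, t', ht, ht'⟩ := K
  obtain ⟨l, u, u', hu, hu'⟩ := L
  obtain rfl : k = l := h
  obtain rfl : t = u := by
    ext1 s
    exact Lp.ext ((ht s).trans (hu s).symm)
  obtain rfl : t' = u' := by
    ext1 s
    exact Lp.ext ((ht' s).trans (hu' s).symm)
  rfl

instance : Zero K0Kernel where
  zero :=
    { kern := 0
      t := 0
      t' := 0
      t_coeFn := fun s => by
        filter_upwards [Lp.coeFn_zero ℂ 2 (volume : Measure ℝ)] with x hx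
        simp
      t'_coeFn := fun s => by
        filter_upwards [Lp.coeFn_zero ℂ 2 (volume : Measure ℝ)] with x hx
        simp }

/-- `T` is the integral operator on `L²` with kernel `K`. -/
def IsIntegralOperatorOf (T : L2 →L[ℂ] L2) (K : K0Kernel) : Prop :=
  ∀ f : L2, T f =ᵐ[volume] fun s => ∫ x, K.kern (s, x) * f x

/-- `R` is a resolvent kernel for `K` at `z`: a `K⁰`-kernel satisfying the two simultaneous integral
equations everywhere on `ℝ²` and mapping `L²` into square integrable functions. -/
structure IsResolventKernel (K : K0Kernel) (z : ℂ) (R : K0Kernel) : Prop where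
  eq_left : ∀ s t : ℝ,
    R.kern (s, t) - z * ∫ x, K.kern (s, x) * R.kern (x, t) = K.kern (s, t)
  eq_right : ∀ s t : ℝ,
    R.kern (s, t) - z * ∫ x, R.kern (s, x) * K.kern (x, t) = K.kern (s, t)
  bound : ∀ f : L2, ∫⁻ s, ‖∫ x, R.kern (s, x) * f x‖ₑ ^ 2 < ⊤

open Classical in
/-- The resolvent kernel for `K` at `z` (with the value `0` when there is none). Its fields `t`, `t'`
are the resolvent Carleman functions for `K` at `z`. -/
def resolventKernel (K : K0Kernel) (z : ℂ) : K0Kernel :=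
  if h : ∃ R, IsResolventKernel K z R then h.choose else 0

/-- Special parquet support of the `K⁰`-kernel `K` of the integral operator `T`: the `τ n` are
positive and strictly increase to `∞`, the subkernels `χ_n(s) K(s,t)` and `χ_n(s) K(s,t) χ_n(t)`
are `K⁰`-kernels (called `Ksub n` and `Ksub' n`), and the integral operators `P_n T` and `P_n T P_n`
induced by them are nuclear. -/
structure IsParquet (K : K0Kernel) (T : L2 →L[ℂ] L2) (τ : ℕ → ℝ) (Ksub Ksub' : ℕ → K0Kernel) :
    Prop where
  pos : ∀ n, 0 < τ n
  strictMono : StrictMono τ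
  tendsto : Tendsto τ atTop atTop
  sub_apply : ∀ n s t, (Ksub n).kern (s, t) = chi (τ n) s * K.kern (s, t)
  sub'_apply : ∀ n s t, (Ksub' n).kern (s, t) = chi (τ n) s * K.kern (s, t) * chi (τ n) t
  nuclear : ∀ n, IsNuclear (cutoff (τ n) * T)
  nuclear' : ∀ n, IsNuclear (cutoff (τ n) * T * cutoff (τ n))

/-- `λ_n(λ) = λ (1 - β_n λ)⁻¹`. -/
def lamSeq (β : ℕ → ℂ) (n : ℕ) (z : ℂ) : ℂ :=
  z * (1 - β n * z)⁻¹

/-- The sequence `β_n I + P_n T`. -/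
def shiftedSub (β : ℕ → ℂ) (τ : ℕ → ℝ) (T : L2 →L[ℂ] L2) (n : ℕ) : L2 →L[ℂ] L2 :=
  β n • (1 : L2 →L[ℂ] L2) + cutoff (τ n) * T

/-- The sequence `β_n I + P_n T P_n`. -/
def shiftedSub' (β : ℕ → ℂ) (τ : ℕ → ℝ) (T : L2 →L[ℂ] L2) (n : ℕ) : L2 →L[ℂ] L2 :=
  β n • (1 : L2 →L[ℂ] L2) + cutoff (τ n) * T * cutoff (τ n)

end

/-!
The argument rests on one notion: a family of bounded operators is *stable* along a filter
(`IsStable`) if its members are eventually invertible with uniformly bounded inverses. The inverses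
of a stable family which converges strongly to an invertible operator converge strongly to its
inverse (`IsStable.tendsto_inverse_apply`), and stability survives perturbations small in norm
(`IsStable.of_tendsto_norm_sub`).

The cutoffs `P n` tend to the identity strongly, so both `β n + P n T` and `β n + P n T P n` tend to
`T` strongly. For such a sequence `S n`, membership of `ζ ≠ 0` in `nablaS S` amounts to the
stability of `1 - ζ S n` together with the invertibility of `1 - ζ T` (`mem_nablaS_iff`). The
perturbation `β n` does not affect stability, and `1 - ζ P T P` and `1 - ζ P T` are stable together
because `1 - a b` and `1 - b a` are invertible together. Hence the two sets `nablaS` are equal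
(`nablaS_shiftedSub'`) and contained in the set of regular values of `T`.

At a regular value `z`, with `R = (1 - z T)⁻¹`, the unique resolvent kernel is
`K(s, t) + z ⟪t(s), R t'(t)⟫`, and its Carleman functions are `R* t(s)` and `R t'(t)`
(`explicitResolvent`, `IsResolventKernel.eq_explicitResolvent`). The formula for `t` uses that the
adjoint of `T` is the integral operator with the adjoint kernel, a consequence of Fubini's theorem
(`IsIntegralOperatorOf.coeFn_adjoint_apply`).

The operators `1 - lamSeq β n z • P n T` are stable and strongly convergent jointly as `n → ∞` and
`z → ζ` (`isStable_lamSeq`), and so are their adjoints. A function in `C₀(ℝ, L²)` has relatively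
compact range, on which bounded strong convergence is uniform (`tendsto_postcompCLM`); the
resolvent kernels and Carleman functions of the subkernels therefore converge in supremum norm,
jointly in the index and the parameter. Joint convergence at every point of a compact set is uniform
convergence on it (`tendstoUniformlyOn_of_tendsto_prod_nhds`).
-/

/-! ### Uniform convergence on compact sets -/

/-- If `F i y → G x` as `(i, y) → (∞, x)` for every `x` in a compact set, then `F i → G` uniformly
on this set. No continuity of `G` is presupposed: it follows from the joint limits. -/
lemma tendstoUniformlyOn_of_tendsto_prod_nhds {ι X Y : Type*} [TopologicalSpace X]
    [PseudoMetricSpace Y] {l : Filter ι} {F : ι → X → Y} {G : X → Y} {C : Set X}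
    (hC : IsCompact C)
    (h : ∀ x ∈ C, Tendsto (fun p : ι × X => F p.1 p.2) (l ×ˢ 𝓝 x) (𝓝 (G x))) :
    TendstoUniformlyOn F G l C := by
  rcases l.eq_or_neBot with rfl | hl
  · intro u _
    simp
  rw [← tendstoLocallyUniformlyOn_iff_tendstoUniformlyOn_of_compact hC,
    Metric.tendstoLocallyUniformlyOn_iff]
  intro ε hε x hx
  obtain ⟨p, hp, q, hq, hpq⟩ := eventually_prod_iff.1
    (Metric.tendsto_nhds.1 (h x hx) (ε / 2) (half_pos hε))
  refine ⟨{y | q y} ∩ C, inter_mem (mem_nhdsWithin_of_mem_nhds hq) self_mem_nhdsWithin, ?_⟩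
  filter_upwards [hp] with i hi y hy
  -- letting the index tend to infinity at the fixed point `y` bounds `G y` against `G x`
  have hy' : Tendsto (fun j => F j y) l (𝓝 (G y)) :=
    (h y hy.2).comp (tendsto_id.prodMk tendsto_const_nhds)
  have h1 : dist (G y) (G x) ≤ ε / 2 :=
    le_of_tendsto (hy'.dist tendsto_const_nhds) (hp.mono fun j hj => (hpq hj hy.1).le)
  have h2 := hpq hi hy.1
  rw [dist_comm] at h2
  calc dist (G y) (F i y) ≤ dist (G y) (G x) + dist (G x) (F i y) := dist_triangle _ _ _
    _ < ε := by linarith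

/-! ### Functions vanishing at infinity -/

namespace ZeroAtInftyContinuousMap

variable {ι X Y E F : Type*} [TopologicalSpace X] [TopologicalSpace Y]

lemma norm_apply_le [NormedAddCommGroup E] (f : C₀(X, E)) (x : X) : ‖f x‖ ≤ ‖f‖ :=
  f.toBCF.norm_coe_le_norm x

lemma norm_le_of_forall [NormedAddCommGroup E] {f : C₀(X, E)} {C : ℝ} (hC : 0 ≤ C)
    (h : ∀ x, ‖f x‖ ≤ C) : ‖f‖ ≤ C :=
  (BoundedContinuousFunction.norm_le (f := f.toBCF) hC).2 h

lemma tendsto_of_forall_eventually [NormedAddCommGroup E] {l : Filter ι} {f : ι → C₀(X, E)}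
    {g : C₀(X, E)} (h : ∀ ε > 0, ∀ᶠ i in l, ∀ x, ‖f i x - g x‖ < ε) : Tendsto f l (𝓝 g) := by
  rw [tendsto_iff_tendstoUniformly, Metric.tendstoUniformly_iff]
  intro ε hε
  filter_upwards [h ε hε] with i hi x
  rw [dist_comm, dist_eq_norm]
  exact hi x

/-- Evaluation at a point is continuous on `C₀(X, E)`. -/
lemma tendsto_apply [NormedAddCommGroup E] {l : Filter ι} {f : ι → C₀(X, E)}
    {g : C₀(X, E)} (h : Tendsto f l (𝓝 g)) (x : X) : Tendsto (fun i => f i x) l (𝓝 (g x)) :=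
  (tendsto_iff_tendstoUniformly.1 h).tendsto_at x

lemma exists_isCompact_range_subset [NormedAddCommGroup E] (f : C₀(X, E)) :
    ∃ S : Set E, IsCompact S ∧ ∀ x, f x ∈ S := by
  refine ⟨insert 0 (Set.range f), ?_, fun x => Or.inr ⟨x, rfl⟩⟩
  exact f.zero_at_infty'.isCompact_insert_range_of_cocompact f.continuous

variable [NormedAddCommGroup E] [InnerProductSpace ℂ E] [NormedAddCommGroup F] [NormedSpace ℂ F]

/-- Composition of a function vanishing at infinity with a bounded operator. -/
noncomputable def postcompCLM (A : E →L[ℂ] F) (f : C₀(X, E)) : C₀(X, F) where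
  toFun x := A (f x)
  continuous_toFun := A.continuous.comp f.continuous
  zero_at_infty' := by
    have := (A.continuous.tendsto 0).comp f.zero_at_infty'
    rwa [map_zero] at this

@[simp] lemma postcompCLM_apply (A : E →L[ℂ] F) (f : C₀(X, E)) (x : X) : postcompCLM A f x = A (f x) :=
  rfl

/-- A bounded, strongly convergent family of operators converges uniformly on the relatively compact
range of a function vanishing at infinity. -/
lemma tendsto_postcompCLM {l : Filter ι} {A : ι → E →L[ℂ] F} {B : E →L[ℂ] F} {M : ℝ}
    (hM : ∀ᶠ i in l, ‖A i‖ ≤ M) (hA : ∀ v, Tendsto (fun i => A i v) l (𝓝 (B v)))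
    {f : ι → C₀(X, E)} {g : C₀(X, E)} (hf : Tendsto f l (𝓝 g)) :
    Tendsto (fun i => postcompCLM (A i) (f i)) l (𝓝 (postcompCLM B g)) := by
  obtain ⟨S, hS, hgS⟩ := g.exists_isCompact_range_subset
  have hunif : TendstoUniformlyOn (fun i v => A i v) B l S := by
    refine tendstoUniformlyOn_of_tendsto_prod_nhds hS fun v _ => ?_
    have h1 : Tendsto (fun p : ι × E => A p.1 (p.2 - v)) (l ×ˢ 𝓝 v) (𝓝 0) := by
      have h0 : Tendsto (fun p : ι × E => M * ‖p.2 - v‖) (l ×ˢ 𝓝 v) (𝓝 0) := by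
        have : Tendsto (fun w : E => M * ‖w - v‖) (𝓝 v) (𝓝 (M * ‖v - v‖)) :=
          Continuous.tendsto (by fun_prop) v
        rw [sub_self, norm_zero, mul_zero] at this
        exact this.comp tendsto_snd
      refine squeeze_zero_norm' ?_ h0
      filter_upwards [tendsto_fst.eventually hM] with p hp
      exact (A p.1).le_of_opNorm_le hp _
    have h2 : Tendsto (fun p : ι × E => A p.1 v) (l ×ˢ 𝓝 v) (𝓝 (B v)) := (hA v).comp tendsto_fst
    have h3 := h1.add h2
    rw [zero_add] at h3
    exact h3.congr fun p => by rw [map_sub, sub_add_cancel]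
  refine tendsto_of_forall_eventually fun ε hε => ?_
  have hfg : Tendsto (fun i => M * ‖f i - g‖) l (𝓝 0) := by
    simpa using (tendsto_iff_norm_sub_tendsto_zero.1 hf).const_mul M
  filter_upwards [hM, hfg.eventually (gt_mem_nhds (half_pos hε)),
    Metric.tendstoUniformlyOn_iff.1 hunif (ε / 2) (half_pos hε)] with i h1 h2 h3 x
  have h4 := h3 (g x) (hgS x)
  rw [dist_comm, dist_eq_norm] at h4
  have h5 : ‖A i (f i x - g x)‖ ≤ M * ‖f i - g‖ :=
    ((A i).le_of_opNorm_le h1 _).trans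
      (mul_le_mul_of_nonneg_left (norm_apply_le (f i - g) x) ((norm_nonneg _).trans h1))
  calc ‖A i (f i x) - B (g x)‖ = ‖A i (f i x - g x) + (A i (g x) - B (g x))‖ := by
        rw [map_sub, sub_add_sub_cancel]
    _ ≤ ‖A i (f i x - g x)‖ + ‖A i (g x) - B (g x)‖ := norm_add_le _ _
    _ < ε := by linarith

/-- The function `(x, y) ↦ ⟪f x, g y⟫` of two variables. -/
noncomputable def innerProd (f : C₀(X, E)) (g : C₀(Y, E)) : C₀(X × Y, ℂ) where
  toFun p := ⟪f p.1, g p.2⟫_ℂ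
  continuous_toFun := by
    have := f.continuous
    have := g.continuous
    fun_prop
  zero_at_infty' := by
    have hf : Tendsto (fun p : X × Y => ‖f p.1‖ * ‖g‖) ((cocompact X).comap Prod.fst) (𝓝 0) := by
      simpa using ((f.zero_at_infty'.norm.comp tendsto_comap).mul_const ‖g‖)
    have hg : Tendsto (fun p : X × Y => ‖f‖ * ‖g p.2‖) ((cocompact Y).comap Prod.snd) (𝓝 0) := by
      simpa using ((g.zero_at_infty'.norm.comp tendsto_comap).const_mul ‖f‖)
    rw [← coprod_cocompact, Filter.coprod]
    refine Tendsto.sup (squeeze_zero_norm (fun p => ?_) hf) (squeeze_zero_norm (fun p => ?_) hg)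
    · exact (norm_inner_le_norm _ _).trans
        (mul_le_mul_of_nonneg_left (g.norm_apply_le _) (norm_nonneg _))
    · exact (norm_inner_le_norm _ _).trans
        (mul_le_mul_of_nonneg_right (f.norm_apply_le _) (norm_nonneg _))

@[simp] lemma innerProd_apply (f : C₀(X, E)) (g : C₀(Y, E)) (p : X × Y) :
    innerProd f g p = ⟪f p.1, g p.2⟫_ℂ :=
  rfl

lemma norm_innerProd_le (f : C₀(X, E)) (g : C₀(Y, E)) : ‖innerProd f g‖ ≤ ‖f‖ * ‖g‖ :=
  norm_le_of_forall (by positivity) fun p => (norm_inner_le_norm _ _).trans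
    (mul_le_mul (f.norm_apply_le _) (g.norm_apply_le _) (norm_nonneg _) (norm_nonneg _))

lemma tendsto_innerProd {l : Filter ι} {f : ι → C₀(X, E)} {f' : C₀(X, E)} {g : ι → C₀(Y, E)}
    {g' : C₀(Y, E)} (hf : Tendsto f l (𝓝 f')) (hg : Tendsto g l (𝓝 g')) :
    Tendsto (fun i => innerProd (f i) (g i)) l (𝓝 (innerProd f' g')) := by
  rw [tendsto_iff_norm_sub_tendsto_zero]
  have h0 : Tendsto (fun i => ‖f i - f'‖ * ‖g i‖ + ‖f'‖ * ‖g i - g'‖) l (𝓝 0) := by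
    have := ((tendsto_iff_norm_sub_tendsto_zero.1 hf).mul hg.norm).add
      ((tendsto_iff_norm_sub_tendsto_zero.1 hg).const_mul ‖f'‖)
    simpa using this
  refine squeeze_zero (fun _ => norm_nonneg _) (fun i => ?_) h0
  have e : innerProd (f i) (g i) - innerProd f' g'
      = innerProd (f i - f') (g i) + innerProd f' (g i - g') := by
    ext p
    simp
  rw [e]
  exact (norm_add_le _ _).trans (add_le_add (norm_innerProd_le _ _) (norm_innerProd_le _ _))

end ZeroAtInftyContinuousMap

/-! ### Stable families of operators -/

section Stable

/-- Quantitative openness of the group of units of a complete normed ring. -/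
lemma isUnit_and_norm_inverse_le_of_norm_sub_mul_le {A : Type*} [NormedRing A] [CompleteSpace A]
    {U V : A} {M : ℝ} (hU : IsUnit U) (hM : ‖Ring.inverse U‖ ≤ M) (h : ‖V - U‖ * M ≤ 1 / 2) :
    IsUnit V ∧ ‖Ring.inverse V‖ ≤ 2 * M := by
  have hW : ‖Ring.inverse U * (U - V)‖ ≤ 1 / 2 := by
    refine (norm_mul_le _ _).trans (le_trans ?_ h)
    rw [mul_comm, norm_sub_rev]
    exact mul_le_mul_of_nonneg_left hM (norm_nonneg _)
  have hV : IsUnit V := by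
    have e : V = U * (1 - Ring.inverse U * (U - V)) := by
      rw [mul_sub, ← mul_assoc, Ring.mul_inverse_cancel _ hU, one_mul, mul_one, sub_sub_cancel]
    rw [e]
    exact hU.mul (isUnit_one_sub_of_norm_lt_one (by linarith))
  refine ⟨hV, ?_⟩
  have e : Ring.inverse V = Ring.inverse U + Ring.inverse U * (U - V) * Ring.inverse V := by
    rw [mul_sub, sub_mul, Ring.inverse_mul_cancel _ hU, one_mul, mul_assoc,
      Ring.mul_inverse_cancel _ hV, mul_one, add_sub_cancel]
  have h1 : ‖Ring.inverse V‖ ≤ M + 1 / 2 * ‖Ring.inverse V‖ := by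
    nth_rewrite 1 [e]
    refine (norm_add_le _ _).trans (add_le_add hM ((norm_mul_le _ _).trans ?_))
    exact mul_le_mul_of_nonneg_right hW (norm_nonneg _)
  linarith

variable {ι E : Type*} [NormedAddCommGroup E] {l : Filter ι}

/-- A family of bounded operators is stable along a filter if its members are eventually invertible,
with inverses bounded in norm by one constant. -/
def IsStable [NormedSpace ℂ E] (U : ι → E →L[ℂ] E) (l : Filter ι) : Prop :=
  ∃ M : ℝ, ∀ᶠ i in l, IsUnit (U i) ∧ ‖Ring.inverse (U i)‖ ≤ M

section Banach

variable [NormedSpace ℂ E]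

lemma IsStable.comp_tendsto {κ : Type*} {l' : Filter κ} {U : ι → E →L[ℂ] E} (hU : IsStable U l)
    {φ : κ → ι} (hφ : Tendsto φ l' l) : IsStable (fun k => U (φ k)) l' :=
  let ⟨M, hM⟩ := hU
  ⟨M, hφ.eventually hM⟩

/-- Stability survives perturbations that tend to zero in norm. -/
lemma IsStable.of_tendsto_norm_sub [CompleteSpace E] {U V : ι → E →L[ℂ] E} (hU : IsStable U l)
    (h : Tendsto (fun i => ‖V i - U i‖) l (𝓝 0)) : IsStable V l := by
  obtain ⟨M, hM⟩ := hU
  have h' : Tendsto (fun i => ‖V i - U i‖ * M) l (𝓝 0) := by simpa using h.mul_const M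
  refine ⟨2 * M, ?_⟩
  filter_upwards [hM, h'.eventually (ge_mem_nhds one_half_pos)] with i h1 h2
  exact isUnit_and_norm_inverse_le_of_norm_sub_mul_le h1.1 h1.2 h2

/-- The inverses of a stable family converge strongly to the inverse of its strong limit. -/
lemma IsStable.tendsto_inverse_apply {U : ι → E →L[ℂ] E} {V : E →L[ℂ] E} (hU : IsStable U l)
    (hV : IsUnit V) (h : ∀ f, Tendsto (fun i => U i f) l (𝓝 (V f))) (f : E) :
    Tendsto (fun i => Ring.inverse (U i) f) l (𝓝 (Ring.inverse V f)) := by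
  obtain ⟨M, hM⟩ := hU
  have hVf : V (Ring.inverse V f) = f := by
    rw [← mul_apply_eq_comp, Ring.mul_inverse_cancel _ hV,
      one_apply_eq_self]
  rw [tendsto_iff_norm_sub_tendsto_zero]
  have h0 : Tendsto (fun i => M * ‖f - U i (Ring.inverse V f)‖) l (𝓝 0) := by
    have := ((h (Ring.inverse V f)).const_sub f).norm.const_mul M
    simpa [hVf] using this
  refine squeeze_zero' (Eventually.of_forall fun _ => norm_nonneg _) ?_ h0
  filter_upwards [hM] with i hi
  have e : Ring.inverse (U i) f - Ring.inverse V f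
      = Ring.inverse (U i) (f - U i (Ring.inverse V f)) := by
    rw [map_sub, ← mul_apply_eq_comp (Ring.inverse (U i)) (U i),
      Ring.inverse_mul_cancel _ hi.1, one_apply_eq_self]
  rw [e]
  exact ContinuousLinearMap.le_of_opNorm_le _ hi.2 _

/-- If a stable, bounded sequence converges strongly and so do its inverses, then the strong limit is
invertible: it is bounded below, and onto because `U i (U i)⁻¹ f = f` passes to the limit. -/
lemma IsStable.isUnit_of_tendsto [CompleteSpace E] [l.NeBot] {U : ι → E →L[ℂ] E} {V : E →L[ℂ] E}
    (hU : IsStable U l) {M' : ℝ} (hM' : ∀ᶠ i in l, ‖U i‖ ≤ M')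
    (h : ∀ f, Tendsto (fun i => U i f) l (𝓝 (V f)))
    (hinv : ∀ f, ∃ g, Tendsto (fun i => Ring.inverse (U i) f) l (𝓝 g)) : IsUnit V := by
  obtain ⟨M, hM⟩ := hU
  rw [ContinuousLinearMap.isUnit_iff_bijective]
  constructor
  · rw [injective_iff_map_eq_zero]
    intro f hf
    have h1 : Tendsto (fun i => M * ‖U i f‖) l (𝓝 0) := by
      simpa [hf] using (h f).norm.const_mul M
    have h2 : ‖f‖ ≤ 0 := by
      refine ge_of_tendsto h1 (hM.mono fun i hi => ?_)
      have e : f = Ring.inverse (U i) (U i f) := by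
        rw [← mul_apply_eq_comp, Ring.inverse_mul_cancel _ hi.1,
          one_apply_eq_self]
      nth_rewrite 1 [e]
      exact ContinuousLinearMap.le_of_opNorm_le _ hi.2 _
    exact norm_le_zero_iff.1 h2
  · intro f
    obtain ⟨g, hg⟩ := hinv f
    refine ⟨g, tendsto_nhds_unique (h g) ?_⟩
    rw [tendsto_iff_norm_sub_tendsto_zero]
    have h0 : Tendsto (fun i => M' * ‖g - Ring.inverse (U i) f‖) l (𝓝 0) := by
      simpa using (hg.const_sub g).norm.const_mul M'
    refine squeeze_zero' (Eventually.of_forall fun _ => norm_nonneg _) ?_ h0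
    filter_upwards [hM, hM'] with i hi hi'
    have e : U i g - f = U i (g - Ring.inverse (U i) f) := by
      rw [map_sub, ← mul_apply_eq_comp (U i) (Ring.inverse (U i)),
        Ring.mul_inverse_cancel _ hi.1, one_apply_eq_self]
    rw [e]
    exact ContinuousLinearMap.le_of_opNorm_le _ hi' _

lemma tendsto_apply_of_norm_le {A : ι → E →L[ℂ] E} {M : ℝ} (hM : ∀ᶠ i in l, ‖A i‖ ≤ M)
    {x : ι → E} {v w : E} (hA : Tendsto (fun i => A i v) l (𝓝 w)) (hx : Tendsto x l (𝓝 v)) :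
    Tendsto (fun i => A i (x i)) l (𝓝 w) := by
  have h0 : Tendsto (fun i => M * ‖x i - v‖) l (𝓝 0) := by
    simpa using (tendsto_iff_norm_sub_tendsto_zero.1 hx).const_mul M
  have h1 : Tendsto (fun i => A i (x i - v)) l (𝓝 0) := by
    refine squeeze_zero_norm' ?_ h0
    filter_upwards [hM] with i hi
    exact (A i).le_of_opNorm_le hi _
  have h2 := h1.add hA
  rw [zero_add] at h2
  exact h2.congr fun i => by rw [map_sub, sub_add_cancel]

end Banach

section Hilbert

variable [InnerProductSpace ℂ E] [CompleteSpace E]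

lemma adjoint_inverse (U : E →L[ℂ] E) :
    ContinuousLinearMap.adjoint (Ring.inverse U) = Ring.inverse (ContinuousLinearMap.adjoint U) := by
  rw [← ContinuousLinearMap.star_eq_adjoint, ← ContinuousLinearMap.star_eq_adjoint,
    Ring.inverse_star]

lemma isUnit_adjoint {U : E →L[ℂ] E} (hU : IsUnit U) : IsUnit (ContinuousLinearMap.adjoint U) := by
  rw [← ContinuousLinearMap.star_eq_adjoint]
  exact hU.star

lemma IsStable.adjoint {U : ι → E →L[ℂ] E} (hU : IsStable U l) :
    IsStable (fun i => ContinuousLinearMap.adjoint (U i)) l := by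
  obtain ⟨M, hM⟩ := hU
  refine ⟨M, hM.mono fun i hi => ⟨isUnit_adjoint hi.1, ?_⟩⟩
  rw [← adjoint_inverse, LinearIsometryEquiv.norm_map]
  exact hi.2

end Hilbert

/-- If `1 - a b` is invertible, then so is `1 - b a`, with inverse `1 + b (1 - a b)⁻¹ a`. -/
lemma isUnit_one_sub_mul_swap {A : Type*} [Ring A] {a b : A} (h : IsUnit (1 - a * b)) :
    IsUnit (1 - b * a) ∧ Ring.inverse (1 - b * a) = 1 + b * Ring.inverse (1 - a * b) * a := by
  have h1 := Ring.mul_inverse_cancel _ h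
  have h2 := Ring.inverse_mul_cancel _ h
  set r := Ring.inverse (1 - a * b)
  have e1 : (1 - b * a) * (1 + b * r * a) = 1 := by
    calc (1 - b * a) * (1 + b * r * a) = 1 - b * a + b * ((1 - a * b) * r) * a := by noncomm_ring
      _ = 1 := by rw [h1]; noncomm_ring
  have e2 : (1 + b * r * a) * (1 - b * a) = 1 := by
    calc (1 + b * r * a) * (1 - b * a) = 1 - b * a + b * (r * (1 - a * b)) * a := by noncomm_ring
      _ = 1 := by rw [h2]; noncomm_ring
  let u : Aˣ := ⟨1 - b * a, 1 + b * r * a, e1, e2⟩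
  exact ⟨u.isUnit, Ring.inverse_unit u⟩

end Stable

/-! ### The truncations -/

lemma L2.norm_sq_eq_integral (f : L2) : ‖f‖ ^ 2 = ∫ x, ‖f x‖ ^ 2 := by
  have h : ((‖f‖ ^ 2 : ℝ) : ℂ) = ((∫ x, ‖f x‖ ^ 2 : ℝ) : ℂ) := by
    rw [← integral_complex_ofReal]
    push_cast
    refine (inner_self_eq_norm_sq_to_K (𝕜 := ℂ) f).symm.trans ?_
    rw [L2.inner_def]
    refine integral_congr_ae (Eventually.of_forall fun x => ?_)
    simp only [inner_self_eq_norm_sq_to_K]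
    rfl
  exact_mod_cast h

lemma L2.integrable_norm_sq (f : L2) : Integrable fun x => ‖f x‖ ^ 2 :=
  (memLp_two_iff_integrable_sq_norm (Lp.aestronglyMeasurable f)).1 (Lp.memLp f)

lemma norm_cutoff_le_one (a : ℝ) : ‖cutoff a‖ ≤ 1 :=
  LinearMap.mkContinuous_norm_le _ zero_le_one _

lemma chi_of_mem {a s : ℝ} (h : s ∈ Set.Ioo (-a) a) : chi a s = 1 := by
  simp [chi, h]

lemma chi_of_notMem {a s : ℝ} (h : s ∉ Set.Ioo (-a) a) : chi a s = 0 := by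
  simp [chi, h]

lemma eventually_mem_Ioo {ι : Type*} {l : Filter ι} {a : ι → ℝ} (ha : Tendsto a l atTop) (C : ℝ) :
    ∀ᶠ i in l, ∀ s : ℝ, |s| ≤ C → s ∈ Set.Ioo (-a i) (a i) := by
  filter_upwards [ha.eventually_gt_atTop C] with i hi s hs
  exact abs_lt.1 (hs.trans_lt hi)

lemma norm_chi_sub_one_le (a s : ℝ) : ‖chi a s - 1‖ ≤ 1 := by
  by_cases h : s ∈ Set.Ioo (-a) a
  · simp [chi_of_mem h]
  · simp [chi_of_notMem h]

lemma cutoff_mul_cutoff (a : ℝ) : cutoff a * cutoff a = cutoff a := by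
  ext1 f
  refine Lp.ext ?_
  filter_upwards [cutoff_coeFn a (cutoff a f), cutoff_coeFn a f] with s h1 h2
  rw [mul_apply_eq_comp, h1, h2]
  by_cases h : s ∈ Set.Ioo (-a) a
  · simp [chi_of_mem h]
  · simp [chi_of_notMem h]

lemma adjoint_cutoff (a : ℝ) : ContinuousLinearMap.adjoint (cutoff a) = cutoff a := by
  symm
  rw [ContinuousLinearMap.eq_adjoint_iff]
  intro f g
  rw [L2.inner_def, L2.inner_def]
  refine integral_congr_ae ?_
  filter_upwards [cutoff_coeFn a f, cutoff_coeFn a g] with s h1 h2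
  rw [h1, h2]
  by_cases h : s ∈ Set.Ioo (-a) a
  · simp [chi_of_mem h]
  · simp [chi_of_notMem h]

lemma tendsto_cutoff_apply {τ : ℕ → ℝ} (hτ : Tendsto τ atTop atTop) (f : L2) :
    Tendsto (fun n => cutoff (τ n) f) atTop (𝓝 f) := by
  have key : Tendsto (fun n => ‖cutoff (τ n) f - f‖ ^ 2) atTop (𝓝 0) := by
    have e : ∀ n, ‖cutoff (τ n) f - f‖ ^ 2 = ∫ x, ‖(chi (τ n) x - 1) * f x‖ ^ 2 := by
      intro n
      rw [L2.norm_sq_eq_integral]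
      refine integral_congr_ae ?_
      filter_upwards [cutoff_coeFn (τ n) f, Lp.coeFn_sub (cutoff (τ n) f) f] with x h1 h2
      rw [h2, Pi.sub_apply, h1, sub_mul, one_mul]
    simp_rw [e]
    rw [← integral_zero ℝ ℝ]
    refine tendsto_integral_of_dominated_convergence (fun x => ‖f x‖ ^ 2) (fun n => ?_)
      (L2.integrable_norm_sq f) (fun n => Eventually.of_forall fun x => ?_)
      (Eventually.of_forall fun x => ?_)
    · have h1 : Measurable (chi (τ n)) := measurable_one.indicator measurableSet_Ioo
      exact ((h1.aestronglyMeasurable.sub aestronglyMeasurable_const).mul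
        (Lp.aestronglyMeasurable f)).norm.pow 2
    · rw [norm_pow, norm_norm, norm_mul]
      gcongr
      exact mul_le_of_le_one_left (norm_nonneg _) (norm_chi_sub_one_le _ _)
    · refine tendsto_const_nhds.congr' ?_
      filter_upwards [eventually_mem_Ioo hτ |x|] with n hn
      simp [chi_of_mem (hn x le_rfl)]
  rw [tendsto_iff_norm_sub_tendsto_zero]
  have h := key.sqrt
  simpa using h

/-- Truncations of a function vanishing at infinity converge to it uniformly. -/
lemma tendsto_of_eq_chi_smul {X E : Type*} [TopologicalSpace X] [NormedAddCommGroup E]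
    [NormedSpace ℂ E] {τ : ℕ → ℝ} (hτ : Tendsto τ atTop atTop) {p : X → ℝ} (hp : Continuous p)
    {f : ℕ → C₀(X, E)} {g : C₀(X, E)} (h : ∀ n x, f n x = chi (τ n) (p x) • g x) :
    Tendsto f atTop (𝓝 g) := by
  refine ZeroAtInftyContinuousMap.tendsto_of_forall_eventually fun ε hε => ?_
  obtain ⟨S, hS, hgS⟩ := mem_cocompact.1
    (g.zero_at_infty' (Metric.ball_mem_nhds (0 : E) hε))
  obtain ⟨C, hC⟩ := (hS.image hp).isBounded.exists_norm_le
  filter_upwards [eventually_mem_Ioo hτ C] with n hn x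
  by_cases hx : x ∈ S
  · rw [h, chi_of_mem (hn _ (hC _ ⟨x, hx, rfl⟩)), one_smul, sub_self, norm_zero]
    exact hε
  · have h1 : ‖g x‖ < ε := by simpa using hgS hx
    have h2 : f n x - g x = (chi (τ n) (p x) - 1) • g x := by rw [h, sub_smul, one_smul]
    rw [h2, norm_smul]
    exact (mul_le_of_le_one_left (norm_nonneg _) (norm_chi_sub_one_le _ _)).trans_lt h1

/-! ### Integral operators with Carleman kernels -/

namespace K0Kernel

lemma inner_t (K : K0Kernel) (s : ℝ) (f : L2) : ⟪K.t s, f⟫_ℂ = ∫ x, K.kern (s, x) * f x := by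
  rw [L2.inner_def]
  refine integral_congr_ae ?_
  filter_upwards [K.t_coeFn s] with x hx
  rw [hx, RCLike.inner_apply', Complex.conj_conj]

lemma inner_t' (K : K0Kernel) (t : ℝ) (f : L2) :
    ⟪K.t' t, f⟫_ℂ = ∫ x, conj (K.kern (x, t)) * f x := by
  rw [L2.inner_def]
  refine integral_congr_ae ?_
  filter_upwards [K.t'_coeFn t] with x hx
  rw [hx, RCLike.inner_apply']

/-- Over a set of finite measure in the second variable, the product of a `K⁰`-kernel with a square
integrable function of the first variable is integrable. -/
lemma integrable_prod (K : K0Kernel) (g : L2) {A : Set ℝ} (hA : volume A < ⊤) :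
    Integrable (fun p : ℝ × ℝ => conj (K.kern (p.2, p.1)) * g p.2)
      ((volume.restrict A).prod volume) := by
  have : IsFiniteMeasure (volume.restrict A) := ⟨by simpa using hA⟩
  have hmeas : AEStronglyMeasurable (fun p : ℝ × ℝ => conj (K.kern (p.2, p.1)) * g p.2)
      ((volume.restrict A).prod volume) := by
    refine AEStronglyMeasurable.mul ?_ (Lp.aestronglyMeasurable g).comp_snd
    have := K.kern.continuous
    have h : Continuous fun p : ℝ × ℝ => conj (K.kern (p.2, p.1)) := by fun_prop
    exact h.aestronglyMeasurable
  have hfib : ∀ y, Integrable (fun s => conj (K.kern (s, y)) * g s) := by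
    intro y
    refine (L2.integrable_inner (𝕜 := ℂ) (K.t' y) g).congr ?_
    filter_upwards [K.t'_coeFn y] with x hx
    rw [hx, RCLike.inner_apply']
  rw [integrable_prod_iff hmeas]
  refine ⟨Eventually.of_forall hfib, ?_⟩
  refine Integrable.mono' (integrable_const (‖K.t'‖ ^ 2 + ‖g‖ ^ 2))
    hmeas.norm.integral_prod_right' (Eventually.of_forall fun y => ?_)
  rw [Real.norm_of_nonneg (integral_nonneg fun _ => norm_nonneg _)]
  -- `|a b| ≤ |a|² + |b|²` bounds the fibre integrals by the norms of the Carleman functions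
  calc ∫ s, ‖conj (K.kern (s, y)) * g s‖ ≤ ∫ s, (‖K.t' y s‖ ^ 2 + ‖g s‖ ^ 2) := by
        refine integral_mono_ae (hfib y).norm
          ((L2.integrable_norm_sq _).add (L2.integrable_norm_sq _)) ?_
        filter_upwards [K.t'_coeFn y] with x hx
        simp only [norm_mul, RCLike.norm_conj, hx]
        nlinarith [sq_nonneg (‖K.kern (x, y)‖ - ‖g x‖), sq_nonneg ‖K.kern (x, y)‖,
          sq_nonneg ‖g x‖]
    _ = ‖K.t' y‖ ^ 2 + ‖g‖ ^ 2 := by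
        rw [integral_add (L2.integrable_norm_sq _) (L2.integrable_norm_sq _),
          ← L2.norm_sq_eq_integral, ← L2.norm_sq_eq_integral]
    _ ≤ ‖K.t'‖ ^ 2 + ‖g‖ ^ 2 := by
        gcongr
        exact K.t'.norm_apply_le y

end K0Kernel

namespace IsIntegralOperatorOf

variable {T : L2 →L[ℂ] L2} {K : K0Kernel}

lemma coeFn_apply (hT : IsIntegralOperatorOf T K) (f : L2) :
    T f =ᵐ[volume] fun s => ⟪K.t s, f⟫_ℂ := by
  filter_upwards [hT f] with s hs
  rw [hs, K.inner_t]

/-- The adjoint of an integral operator with a `K⁰`-kernel is the integral operator with the adjoint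
kernel. Both sides are compared by integrating over sets of finite measure, where Fubini's theorem
applies. -/
lemma coeFn_adjoint_apply (hT : IsIntegralOperatorOf T K) (g : L2) :
    ContinuousLinearMap.adjoint T g =ᵐ[volume] fun y => ⟪K.t' y, g⟫_ℂ := by
  have hcont : Continuous fun y => ⟪K.t' y, g⟫_ℂ := by
    have := K.t'.continuous
    fun_prop
  refine ae_eq_of_forall_setIntegral_eq_of_sigmaFinite (fun A hA hAfin => ?_)
    (fun A hA hAfin => ?_) fun A hA hAfin => ?_
  · have : IsFiniteMeasure (volume.restrict A) := ⟨by simpa using hAfin⟩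
    exact ((Lp.memLp _).restrict A).integrable one_le_two
  · have : IsFiniteMeasure (volume.restrict A) := ⟨by simpa using hAfin⟩
    refine Integrable.mono' (integrable_const (‖K.t'‖ * ‖g‖)) hcont.aestronglyMeasurable
      (Eventually.of_forall fun y => (norm_inner_le_norm _ _).trans ?_)
    gcongr
    exact K.t'.norm_apply_le y
  · have hint := K.integrable_prod g hAfin
    calc ∫ y in A, ContinuousLinearMap.adjoint T g y
        = ⟪indicatorConstLp 2 hA hAfin.ne (1 : ℂ), ContinuousLinearMap.adjoint T g⟫_ℂ := by
          rw [L2.inner_indicatorConstLp_one]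
      _ = ⟪T (indicatorConstLp 2 hA hAfin.ne (1 : ℂ)), g⟫_ℂ := by
          rw [ContinuousLinearMap.adjoint_inner_right]
      _ = ∫ s, ∫ y in A, conj (K.kern (s, y)) * g s := by
          rw [L2.inner_def]
          refine integral_congr_ae ?_
          filter_upwards [hT (indicatorConstLp 2 hA hAfin.ne (1 : ℂ))] with s hs
          rw [hs, RCLike.inner_apply', ← integral_conj, integral_mul_const,
            ← integral_indicator hA]
          congr 1
          refine integral_congr_ae ?_
          filter_upwards [indicatorConstLp_coeFn (p := 2) (hs := hA) (hμs := hAfin.ne)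
            (c := (1 : ℂ))] with y hy
          rw [hy]
          by_cases h : y ∈ A <;> simp [h]
      _ = ∫ y in A, ∫ s, conj (K.kern (s, y)) * g s := (integral_integral_swap hint).symm
      _ = ∫ y in A, ⟪K.t' y, g⟫_ℂ := by simp_rw [K.inner_t']

end IsIntegralOperatorOf

/-! ### Existence and uniqueness of resolvent kernels -/

open ZeroAtInftyContinuousMap ContinuousLinearMap

/-- The inverse `(1 - z T)⁻¹`, with the junk value `0` if `z` is not a regular value of `T`. -/
noncomputable def resolventOp (T : L2 →L[ℂ] L2) (z : ℂ) : L2 →L[ℂ] L2 :=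
  Ring.inverse (1 - z • T)

section Resolvent

variable {T : L2 →L[ℂ] L2} {K : K0Kernel} {z : ℂ}

lemma resolventOp_apply_sub (hz : z ∈ regularValues T) (f : L2) :
    resolventOp T z (f - z • T f) = f := by
  have h := congrArg (fun A : L2 →L[ℂ] L2 => A f) (Ring.inverse_mul_cancel _ hz)
  simpa [resolventOp] using h

lemma resolventOp_apply_eq (hz : z ∈ regularValues T) (f : L2) :
    resolventOp T z f = f + z • T (resolventOp T z f) := by
  have h := congrArg (fun A : L2 →L[ℂ] L2 => A f) (Ring.mul_inverse_cancel _ hz)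
  exact sub_eq_iff_eq_add.1 (by simpa [resolventOp] using h)

lemma adjoint_resolventOp_apply_eq (hz : z ∈ regularValues T) (f : L2) :
    adjoint (resolventOp T z) f
      = f + conj z • adjoint T (adjoint (resolventOp T z) f) := by
  refine ext_inner_left ℂ fun v => ?_
  rw [inner_add_right, inner_smul_right, adjoint_inner_right, adjoint_inner_right,
    adjoint_inner_right]
  have h : resolventOp T z v = v + z • resolventOp T z (T v) := by
    have := resolventOp_apply_sub hz v
    rw [map_sub, map_smul] at this
    exact sub_eq_iff_eq_add.1 this
  conv_lhs => rw [h]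
  rw [inner_add_left, inner_smul_left]

/-- The resolvent kernel at a regular value `z`, given by `K(s, t) + z ⟪t(s), R t'(t)⟫` with
`R = (1 - z T)⁻¹`; its Carleman functions are `R* t(s)` and `R t'(t)`. -/
noncomputable def explicitResolvent (hT : IsIntegralOperatorOf T K) (hz : z ∈ regularValues T) :
    K0Kernel where
  kern := K.kern + z • innerProd K.t (postcompCLM (resolventOp T z) K.t')
  t := postcompCLM (adjoint (resolventOp T z)) K.t
  t' := postcompCLM (resolventOp T z) K.t'
  t_coeFn s := by
    rw [postcompCLM_apply, adjoint_resolventOp_apply_eq hz]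
    filter_upwards [Lp.coeFn_add (K.t s) (conj z • adjoint T (adjoint (resolventOp T z) (K.t s))),
      Lp.coeFn_smul (conj z) (adjoint T (adjoint (resolventOp T z) (K.t s))), K.t_coeFn s,
      hT.coeFn_adjoint_apply (adjoint (resolventOp T z) (K.t s))] with x h1 h2 h3 h4
    rw [h1, Pi.add_apply, h2, Pi.smul_apply, h3, h4, adjoint_inner_right]
    simp
  t'_coeFn t := by
    rw [postcompCLM_apply]
    conv_lhs => rw [resolventOp_apply_eq hz]
    filter_upwards [Lp.coeFn_add (K.t' t) (z • T (resolventOp T z (K.t' t))),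
      Lp.coeFn_smul z (T (resolventOp T z (K.t' t))), K.t'_coeFn t,
      hT.coeFn_apply (resolventOp T z (K.t' t))] with x h1 h2 h3 h4
    rw [h1, Pi.add_apply, h2, Pi.smul_apply, h3, h4]
    simp

lemma explicitResolvent_kern_apply (hT : IsIntegralOperatorOf T K) (hz : z ∈ regularValues T)
    (s t : ℝ) : (explicitResolvent hT hz).kern (s, t)
      = K.kern (s, t) + z * ⟪K.t s, resolventOp T z (K.t' t)⟫_ℂ := by
  simp [explicitResolvent]

lemma K0Kernel.integral_kern_mul_kern (K L : K0Kernel) (s t : ℝ) :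
    ∫ x, K.kern (s, x) * L.kern (x, t) = ⟪K.t s, L.t' t⟫_ℂ := by
  rw [K.inner_t]
  refine integral_congr_ae ?_
  filter_upwards [L.t'_coeFn t] with x hx
  rw [hx]

lemma isResolventKernel_explicitResolvent (hT : IsIntegralOperatorOf T K)
    (hz : z ∈ regularValues T) : IsResolventKernel K z (explicitResolvent hT hz) where
  eq_left s t := by
    rw [K0Kernel.integral_kern_mul_kern, explicitResolvent_kern_apply]
    simp [explicitResolvent]
  eq_right s t := by
    rw [K0Kernel.integral_kern_mul_kern, explicitResolvent_kern_apply]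
    simp [explicitResolvent, adjoint_inner_left]
  bound f := by
    -- the integral operator with this kernel is `T R`
    have h : (fun s => ∫ x, (explicitResolvent hT hz).kern (s, x) * f x)
        =ᵐ[volume] T (resolventOp T z f) := by
      filter_upwards [hT.coeFn_apply (resolventOp T z f)] with s hs
      rw [← K0Kernel.inner_t, hs]
      simp [explicitResolvent, adjoint_inner_left]
    have h2 : ∫⁻ s, ‖∫ x, (explicitResolvent hT hz).kern (s, x) * f x‖ₑ ^ 2
        = ∫⁻ s, ‖T (resolventOp T z f) s‖ₑ ^ 2 := by
      refine lintegral_congr_ae ?_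
      filter_upwards [h] with s hs
      rw [hs]
    rw [h2]
    have h3 := lintegral_rpow_enorm_lt_top_of_eLpNorm_lt_top two_ne_zero ENNReal.ofNat_ne_top
      (Lp.memLp (T (resolventOp T z f))).2
    simpa using h3

/-- The first integral equation alone determines the resolvent kernel: it says that its column
functions solve `(1 - z T) f = t'(t)`. -/
lemma IsResolventKernel.eq_explicitResolvent (hT : IsIntegralOperatorOf T K)
    (hz : z ∈ regularValues T) {R : K0Kernel} (hR : IsResolventKernel K z R) :
    R = explicitResolvent hT hz := by
  have hker : ∀ s t, R.kern (s, t) = K.kern (s, t) + z * ⟪K.t s, R.t' t⟫_ℂ := by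
    intro s t
    rw [← K0Kernel.integral_kern_mul_kern]
    exact sub_eq_iff_eq_add.1 (hR.eq_left s t)
  have ht' : ∀ t, R.t' t = resolventOp T z (K.t' t) := by
    intro t
    have h : R.t' t - z • T (R.t' t) = K.t' t := by
      refine Lp.ext ?_
      filter_upwards [Lp.coeFn_sub (R.t' t) (z • T (R.t' t)), Lp.coeFn_smul z (T (R.t' t)),
        R.t'_coeFn t, K.t'_coeFn t, hT.coeFn_apply (R.t' t)] with x h1 h2 h3 h4 h5
      rw [h1, Pi.sub_apply, h2, Pi.smul_apply, h3, h4, h5, hker]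
      simp
    rw [← h, resolventOp_apply_sub hz]
  refine K0Kernel.ext_kern (ZeroAtInftyContinuousMap.ext ?_)
  rintro ⟨s, t⟩
  rw [hker, explicitResolvent_kern_apply, ht']

lemma existsUnique_isResolventKernel (hT : IsIntegralOperatorOf T K) (hz : z ∈ regularValues T) :
    ∃! R, IsResolventKernel K z R :=
  ⟨explicitResolvent hT hz, isResolventKernel_explicitResolvent hT hz,
    fun _ hR => hR.eq_explicitResolvent hT hz⟩

lemma resolventKernel_eq (hT : IsIntegralOperatorOf T K) (hz : z ∈ regularValues T) :
    resolventKernel K z = explicitResolvent hT hz := by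
  have h : ∃ R, IsResolventKernel K z R := (existsUnique_isResolventKernel hT hz).exists
  rw [resolventKernel, dif_pos h]
  exact h.choose_spec.eq_explicitResolvent hT hz

end Resolvent

/-! ### The sets of strong convergence -/

/-- For a bounded sequence with a strong limit `T`, membership in `nablaS` means stability of
`1 - ζ S n` together with regularity of `ζ` for `T`. -/
lemma mem_nablaS_iff {S : ℕ → L2 →L[ℂ] L2} {T : L2 →L[ℂ] L2} {M' : ℝ}
    (hM' : ∀ᶠ n in atTop, ‖S n‖ ≤ M') (hS : ∀ f, Tendsto (fun n => S n f) atTop (𝓝 (T f)))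
    {ζ : ℂ} : ζ ∈ nablaS S ↔
      ζ ≠ 0 ∧ IsStable (fun n => 1 - ζ • S n) atTop ∧ ζ ∈ regularValues T := by
  have hlim : ∀ f, Tendsto (fun n => (1 - ζ • S n) f) atTop (𝓝 ((1 - ζ • T) f)) := fun f =>
    ((hS f).const_smul ζ).const_sub f
  have hbdd : ∀ᶠ n in atTop, ‖1 - ζ • S n‖ ≤ 1 + ‖ζ‖ * M' := by
    filter_upwards [hM'] with n hn
    refine (norm_sub_le _ _).trans (add_le_add norm_id_le ?_)
    rw [norm_smul]
    gcongr
  have hinv : ∀ n, IsUnit (1 - ζ • S n) →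
      Ring.inverse (1 - ζ • S n) = 1 + ζ • fredholmResolvent (S n) ζ := by
    intro n hn
    have h := Ring.mul_inverse_cancel _ hn
    rw [sub_mul, one_mul, smul_mul_assoc] at h
    exact sub_eq_iff_eq_add.1 h
  constructor
  · rintro ⟨⟨h0, M, -, N, hN⟩, hconv⟩
    have hN' : ∀ᶠ n in atTop, ζ ∈ regularValues (S n) ∧ ‖fredholmResolvent (S n) ζ‖ ≤ M :=
      (eventually_gt_atTop N).mono hN
    have hst : IsStable (fun n => 1 - ζ • S n) atTop := by
      refine ⟨1 + ‖ζ‖ * M, hN'.mono fun n hn => ⟨hn.1, ?_⟩⟩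
      rw [hinv n hn.1]
      refine (norm_add_le _ _).trans (add_le_add norm_id_le ?_)
      rw [norm_smul]
      exact mul_le_mul_of_nonneg_left hn.2 (norm_nonneg _)
    refine ⟨h0, hst, hst.isUnit_of_tendsto hbdd hlim fun f => ?_⟩
    obtain ⟨g, hg⟩ := hconv f
    refine ⟨f + ζ • g, ((hg.const_smul ζ).const_add f).congr' ?_⟩
    filter_upwards [hN'] with n hn
    rw [hinv n hn.1]
    rfl
  · rintro ⟨h0, hst, hT⟩
    refine ⟨⟨h0, ?_⟩, fun f => ⟨T (Ring.inverse (1 - ζ • T) f), ?_⟩⟩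
    · obtain ⟨M, hM⟩ := hst
      obtain ⟨N, hN⟩ := eventually_atTop.1 (hM.and hM')
      refine ⟨max 1 (M' * M), lt_max_of_lt_left one_pos, N, fun n hn => ?_⟩
      obtain ⟨⟨h1, h2⟩, h3⟩ := hN n (le_of_lt hn)
      refine ⟨h1, le_max_of_le_right ((norm_mul_le _ _).trans ?_)⟩
      exact mul_le_mul h3 h2 (norm_nonneg _) ((norm_nonneg _).trans h3)
    · exact tendsto_apply_of_norm_le hM' (hS _) (hst.tendsto_inverse_apply hT hlim f)

section Parquet

variable {β : ℕ → ℂ} {τ : ℕ → ℝ} {T : L2 →L[ℂ] L2}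

lemma tendsto_norm_smul_add_sub (hβ : Tendsto β atTop (𝓝 0)) (ζ : ℂ) (A : ℕ → L2 →L[ℂ] L2) :
    Tendsto (fun n => ‖(1 - ζ • (β n • (1 : L2 →L[ℂ] L2) + A n)) - (1 - ζ • A n)‖) atTop (𝓝 0) := by
  have h : Tendsto (fun n => ζ • β n • (1 : L2 →L[ℂ] L2)) atTop (𝓝 0) := by
    simpa using (hβ.smul_const (1 : L2 →L[ℂ] L2)).const_smul ζ
  refine h.norm.congr' (Eventually.of_forall fun n => ?_) |>.trans (by simp)
  rw [← norm_neg]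
  congr 1
  rw [smul_add]
  abel

lemma isStable_one_sub_smul_add_iff (hβ : Tendsto β atTop (𝓝 0)) (ζ : ℂ)
    (A : ℕ → L2 →L[ℂ] L2) :
    IsStable (fun n => 1 - ζ • (β n • (1 : L2 →L[ℂ] L2) + A n)) atTop ↔
      IsStable (fun n => 1 - ζ • A n) atTop := by
  have h := tendsto_norm_smul_add_sub hβ ζ A
  refine ⟨fun hs => hs.of_tendsto_norm_sub ?_, fun hs => hs.of_tendsto_norm_sub h⟩
  simpa only [norm_sub_rev] using h

lemma eventually_norm_add_le (hβ : Tendsto β atTop (𝓝 0)) {A : ℕ → L2 →L[ℂ] L2}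
    (hA : ∀ n, ‖A n‖ ≤ ‖T‖) :
    ∀ᶠ n in atTop, ‖β n • (1 : L2 →L[ℂ] L2) + A n‖ ≤ 1 + ‖T‖ := by
  have h : Tendsto (fun n => ‖β n • (1 : L2 →L[ℂ] L2)‖) atTop (𝓝 0) := by
    simpa using (hβ.smul_const (1 : L2 →L[ℂ] L2)).norm
  filter_upwards [h.eventually (ge_mem_nhds one_pos)] with n hn
  exact (norm_add_le _ _).trans (add_le_add hn (hA n))

lemma norm_cutoff_mul_le (a : ℝ) (T : L2 →L[ℂ] L2) : ‖cutoff a * T‖ ≤ ‖T‖ :=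
  (norm_mul_le _ _).trans (mul_le_of_le_one_left (norm_nonneg _) (norm_cutoff_le_one a))

lemma norm_cutoff_mul_mul_cutoff_le (a : ℝ) (T : L2 →L[ℂ] L2) :
    ‖cutoff a * T * cutoff a‖ ≤ ‖T‖ :=
  (norm_mul_le _ _).trans ((mul_le_of_le_one_right (norm_nonneg _) (norm_cutoff_le_one a)).trans
    (norm_cutoff_mul_le a T))

lemma tendsto_smul_one_add_apply (hβ : Tendsto β atTop (𝓝 0)) {A : ℕ → L2 →L[ℂ] L2} {f g : L2}
    (hA : Tendsto (fun n => A n f) atTop (𝓝 g)) :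
    Tendsto (fun n => (β n • (1 : L2 →L[ℂ] L2) + A n) f) atTop (𝓝 g) := by
  simpa using (hβ.smul_const f).add hA

lemma tendsto_cutoff_mul_apply (hτ : Tendsto τ atTop atTop) (T : L2 →L[ℂ] L2) (f : L2) :
    Tendsto (fun n => (cutoff (τ n) * T) f) atTop (𝓝 (T f)) :=
  tendsto_cutoff_apply hτ (T f)

lemma tendsto_cutoff_mul_mul_cutoff_apply (hτ : Tendsto τ atTop atTop) (T : L2 →L[ℂ] L2)
    (f : L2) : Tendsto (fun n => (cutoff (τ n) * T * cutoff (τ n)) f) atTop (𝓝 (T f)) :=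
  tendsto_apply_of_norm_le (Eventually.of_forall fun n => norm_cutoff_mul_le (τ n) T)
    (tendsto_cutoff_mul_apply hτ T f) (tendsto_cutoff_apply hτ f)

/-- The two-sided truncations `P T P` and the one-sided ones `P T = P (P T)` are stable together, as
`1 - a b` and `1 - b a` are for `a = ζ P T` and `b = P`. -/
lemma isStable_cutoff_mul_mul_cutoff_iff (ζ : ℂ) :
    IsStable (fun n => 1 - ζ • (cutoff (τ n) * T * cutoff (τ n))) atTop ↔
      IsStable (fun n => 1 - ζ • (cutoff (τ n) * T)) atTop := by
  have e1 : ∀ n, 1 - ζ • (cutoff (τ n) * T * cutoff (τ n))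
      = 1 - (ζ • (cutoff (τ n) * T)) * cutoff (τ n) := fun n => by rw [smul_mul_assoc]
  have e2 : ∀ n, 1 - ζ • (cutoff (τ n) * T)
      = 1 - cutoff (τ n) * (ζ • (cutoff (τ n) * T)) := fun n => by
    rw [mul_smul_comm, ← mul_assoc, cutoff_mul_cutoff]
  have hn : ∀ n, ‖ζ • (cutoff (τ n) * T)‖ ≤ ‖ζ‖ * ‖T‖ := fun n => by
    rw [norm_smul]
    exact mul_le_mul_of_nonneg_left (norm_cutoff_mul_le _ _) (norm_nonneg _)
  simp_rw [e1]
  simp_rw (singlePass := true) [e2]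
  constructor
  · rintro ⟨M, hM⟩
    refine ⟨1 + M * (‖ζ‖ * ‖T‖), hM.mono fun n h => ?_⟩
    obtain ⟨h1, h2⟩ := isUnit_one_sub_mul_swap h.1
    refine ⟨h1, ?_⟩
    rw [h2]
    refine (norm_add_le _ _).trans (add_le_add norm_id_le ((norm_mul_le _ _).trans ?_))
    refine mul_le_mul ((norm_mul_le _ _).trans ?_) (hn n) (norm_nonneg _)
      ((norm_nonneg _).trans h.2)
    exact (mul_le_of_le_one_left (norm_nonneg _) (norm_cutoff_le_one _)).trans h.2
  · rintro ⟨M, hM⟩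
    refine ⟨1 + ‖ζ‖ * ‖T‖ * M, hM.mono fun n h => ?_⟩
    obtain ⟨h1, h2⟩ := isUnit_one_sub_mul_swap h.1
    refine ⟨h1, ?_⟩
    rw [h2]
    refine (norm_add_le _ _).trans (add_le_add norm_id_le ((norm_mul_le _ _).trans ?_))
    refine (mul_le_of_le_one_right (norm_nonneg _) (norm_cutoff_le_one _)).trans
      ((norm_mul_le _ _).trans (mul_le_mul (hn n) h.2 (norm_nonneg _) (by positivity)))

lemma mem_nablaS_shiftedSub_iff (hβ : Tendsto β atTop (𝓝 0)) (hτ : Tendsto τ atTop atTop) {ζ : ℂ} :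
    ζ ∈ nablaS (shiftedSub β τ T) ↔
      ζ ≠ 0 ∧ IsStable (fun n => 1 - ζ • (cutoff (τ n) * T)) atTop ∧ ζ ∈ regularValues T := by
  have h := mem_nablaS_iff (S := shiftedSub β τ T) (T := T) (ζ := ζ)
    (eventually_norm_add_le hβ fun n => norm_cutoff_mul_le (τ n) T)
    fun f => tendsto_smul_one_add_apply hβ (tendsto_cutoff_mul_apply hτ T f)
  rw [h, ← isStable_one_sub_smul_add_iff hβ ζ fun n => cutoff (τ n) * T]
  rfl

/-- The truncations `P T P` and `P T` have the same sets of strong convergence. -/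
lemma nablaS_shiftedSub' (hβ : Tendsto β atTop (𝓝 0)) (hτ : Tendsto τ atTop atTop) :
    nablaS (shiftedSub' β τ T) = nablaS (shiftedSub β τ T) := by
  ext ζ
  have h := mem_nablaS_iff (S := shiftedSub' β τ T) (T := T) (ζ := ζ)
    (eventually_norm_add_le hβ fun n => norm_cutoff_mul_mul_cutoff_le (τ n) T)
    fun f => tendsto_smul_one_add_apply hβ (tendsto_cutoff_mul_mul_cutoff_apply hτ T f)
  rw [h, mem_nablaS_shiftedSub_iff hβ hτ, ← isStable_cutoff_mul_mul_cutoff_iff,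
    ← isStable_one_sub_smul_add_iff hβ ζ fun n => cutoff (τ n) * T * cutoff (τ n)]
  rfl

/-- All sufficiently small `ζ ≠ 0` belong to `nablaS`, by the Neumann series. -/
lemma nablaS_shiftedSub_nonempty (hβ : Tendsto β atTop (𝓝 0)) (hτ : Tendsto τ atTop atTop) :
    (nablaS (shiftedSub β τ T)).Nonempty := by
  have hpos : 0 < 2 * (‖T‖ + 1) := by positivity
  have hunit : ∀ A : L2 →L[ℂ] L2, ‖A‖ ≤ ‖T‖ →
      IsUnit (1 - (((2 * (‖T‖ + 1))⁻¹ : ℝ) : ℂ) • A) ∧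
        ‖Ring.inverse (1 - (((2 * (‖T‖ + 1))⁻¹ : ℝ) : ℂ) • A)‖ ≤ 2 * 1 := by
    intro A hA
    refine isUnit_and_norm_inverse_le_of_norm_sub_mul_le isUnit_one
      (by rw [Ring.inverse_one]; exact norm_id_le) ?_
    rw [sub_sub_cancel_left, norm_neg, norm_smul, mul_one, Complex.norm_real,
      Real.norm_of_nonneg (inv_nonneg.2 hpos.le), inv_mul_le_iff₀ hpos]
    linarith
  refine ⟨(((2 * (‖T‖ + 1))⁻¹ : ℝ) : ℂ), (mem_nablaS_shiftedSub_iff hβ hτ).2 ⟨?_, ?_, ?_⟩⟩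
  · exact Complex.ofReal_ne_zero.2 (inv_ne_zero hpos.ne')
  · exact ⟨2 * 1, Eventually.of_forall fun n => hunit _ (norm_cutoff_mul_le _ _)⟩
  · exact (hunit T le_rfl).1

/-! ### Convergence of the resolvent kernels -/

lemma tendsto_one_sub_mul (hβ : Tendsto β atTop (𝓝 0)) (ζ : ℂ) :
    Tendsto (fun p : ℕ × ℂ => 1 - β p.1 * p.2) (atTop ×ˢ 𝓝 ζ) (𝓝 1) := by
  have h := ((hβ.comp tendsto_fst).mul (tendsto_snd (f := atTop) (g := 𝓝 ζ))).const_sub 1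
  simpa using h

lemma tendsto_lamSeq (hβ : Tendsto β atTop (𝓝 0)) (ζ : ℂ) :
    Tendsto (fun p : ℕ × ℂ => lamSeq β p.1 p.2) (atTop ×ˢ 𝓝 ζ) (𝓝 ζ) := by
  have h := (tendsto_snd (f := atTop) (g := 𝓝 ζ)).mul
    ((tendsto_one_sub_mul hβ ζ).inv₀ one_ne_zero)
  simpa [lamSeq] using h

/-- Stability at `ζ` is stability of the operators with parameter `lamSeq β n z`, jointly as
`n → ∞` and `z → ζ`. -/
lemma isStable_lamSeq (hβ : Tendsto β atTop (𝓝 0)) {ζ : ℂ}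
    (h : IsStable (fun n => 1 - ζ • (cutoff (τ n) * T)) atTop) :
    IsStable (fun p : ℕ × ℂ => 1 - lamSeq β p.1 p.2 • (cutoff (τ p.1) * T)) (atTop ×ˢ 𝓝 ζ) := by
  refine (h.comp_tendsto (tendsto_fst (f := atTop) (g := 𝓝 ζ))).of_tendsto_norm_sub ?_
  have h0 : Tendsto (fun p : ℕ × ℂ => ‖lamSeq β p.1 p.2 - ζ‖ * ‖T‖) (atTop ×ˢ 𝓝 ζ) (𝓝 0) := by
    simpa using (tendsto_iff_norm_sub_tendsto_zero.1 (tendsto_lamSeq hβ ζ)).mul_const ‖T‖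
  refine squeeze_zero (fun _ => norm_nonneg _) (fun p => ?_) h0
  rw [sub_sub_sub_cancel_left, ← sub_smul, norm_smul, norm_sub_rev]
  exact mul_le_mul_of_nonneg_left (norm_cutoff_mul_le _ _) (norm_nonneg _)

variable {K : K0Kernel} {Ksub Ksub' : ℕ → K0Kernel}

namespace IsParquet

lemma isIntegralOperatorOf (hK : IsParquet K T τ Ksub Ksub') (hT : IsIntegralOperatorOf T K)
    (n : ℕ) : IsIntegralOperatorOf (cutoff (τ n) * T) (Ksub n) := by
  intro f
  filter_upwards [cutoff_coeFn (τ n) (T f), hT f] with s h1 h2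
  rw [mul_apply_eq_comp, h1, h2, ← integral_const_mul]
  simp_rw [hK.sub_apply, mul_assoc]

lemma tendsto_kern (hK : IsParquet K T τ Ksub Ksub') :
    Tendsto (fun n => (Ksub n).kern) atTop (𝓝 K.kern) :=
  tendsto_of_eq_chi_smul hK.tendsto continuous_fst fun n x => hK.sub_apply n x.1 x.2

lemma tendsto_t (hK : IsParquet K T τ Ksub Ksub') :
    Tendsto (fun n => (Ksub n).t) atTop (𝓝 K.t) := by
  refine tendsto_of_eq_chi_smul hK.tendsto continuous_id fun n s => Lp.ext ?_
  filter_upwards [(Ksub n).t_coeFn s, K.t_coeFn s, Lp.coeFn_smul (chi (τ n) s) (K.t s)]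
    with x h1 h2 h3
  rw [h1, id, h3, Pi.smul_apply, h2, hK.sub_apply]
  by_cases h : s ∈ Set.Ioo (-τ n) (τ n)
  · simp [chi_of_mem h]
  · simp [chi_of_notMem h]

lemma tendsto_t' (hK : IsParquet K T τ Ksub Ksub') :
    Tendsto (fun n => (Ksub n).t') atTop (𝓝 K.t') := by
  have e : ∀ n, (Ksub n).t' = postcompCLM (cutoff (τ n)) K.t' := by
    intro n
    ext1 t
    refine Lp.ext ?_
    rw [postcompCLM_apply]
    filter_upwards [(Ksub n).t'_coeFn t, K.t'_coeFn t, cutoff_coeFn (τ n) (K.t' t)]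
      with x h1 h2 h3
    rw [h1, h3, h2, hK.sub_apply]
  have e' : K.t' = postcompCLM (1 : L2 →L[ℂ] L2) K.t' := rfl
  simp_rw [e]
  rw [e']
  exact tendsto_postcompCLM (Eventually.of_forall fun n => norm_cutoff_le_one (τ n))
    (tendsto_cutoff_apply hK.tendsto) tendsto_const_nhds

variable {ζ : ℂ}

lemma eventually_mem_regularValues (hK : IsParquet K T τ Ksub Ksub')
    (hβ : Tendsto β atTop (𝓝 0)) (hζ : ζ ∈ nablaS (shiftedSub β τ T)) :
    ∀ᶠ p : ℕ × ℂ in atTop ×ˢ 𝓝 ζ,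
      lamSeq β p.1 p.2 ∈ regularValues (cutoff (τ p.1) * T) := by
  obtain ⟨M, hM⟩ := isStable_lamSeq hβ ((mem_nablaS_shiftedSub_iff hβ hK.tendsto).1 hζ).2.1
  exact hM.mono fun p hp => hp.1

/-- The resolvent Carleman functions `t'` converge jointly in the index and the parameter. -/
lemma tendsto_resolventKernel_t' (hK : IsParquet K T τ Ksub Ksub')
    (hT : IsIntegralOperatorOf T K) (hβ : Tendsto β atTop (𝓝 0))
    (hζ : ζ ∈ nablaS (shiftedSub β τ T)) :
    Tendsto (fun p : ℕ × ℂ => (resolventKernel (Ksub p.1) (lamSeq β p.1 p.2)).t')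
      (atTop ×ˢ 𝓝 ζ) (𝓝 (resolventKernel K ζ).t') := by
  obtain ⟨-, hst, hreg⟩ := (mem_nablaS_shiftedSub_iff hβ hK.tendsto).1 hζ
  have hst' := isStable_lamSeq hβ hst
  obtain ⟨M, hM⟩ := isStable_lamSeq hβ hst
  rw [resolventKernel_eq hT hreg]
  refine (tendsto_postcompCLM (hM.mono fun p hp => hp.2) (fun f => ?_)
    (hK.tendsto_t'.comp tendsto_fst)).congr' ?_
  · refine hst'.tendsto_inverse_apply hreg (fun g => ?_) f
    exact ((tendsto_lamSeq hβ ζ).smul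
      ((tendsto_cutoff_mul_apply hK.tendsto T g).comp tendsto_fst)).const_sub g
  · filter_upwards [hM] with p hp
    rw [resolventKernel_eq (hK.isIntegralOperatorOf hT p.1) hp.1]
    rfl

/-- The resolvent Carleman functions `t` converge jointly in the index and the parameter: the adjoint
operators `1 - conj z T* P` are stable as well, and converge strongly to `1 - conj ζ T*`. -/
lemma tendsto_resolventKernel_t (hK : IsParquet K T τ Ksub Ksub')
    (hT : IsIntegralOperatorOf T K) (hβ : Tendsto β atTop (𝓝 0))
    (hζ : ζ ∈ nablaS (shiftedSub β τ T)) :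
    Tendsto (fun p : ℕ × ℂ => (resolventKernel (Ksub p.1) (lamSeq β p.1 p.2)).t)
      (atTop ×ˢ 𝓝 ζ) (𝓝 (resolventKernel K ζ).t) := by
  obtain ⟨-, hst, hreg⟩ := (mem_nablaS_shiftedSub_iff hβ hK.tendsto).1 hζ
  have hst' := (isStable_lamSeq hβ hst).adjoint
  obtain ⟨M, hM⟩ := isStable_lamSeq hβ hst
  rw [resolventKernel_eq hT hreg]
  refine (tendsto_postcompCLM (M := M)
    (A := fun p : ℕ × ℂ => adjoint (resolventOp (cutoff (τ p.1) * T) (lamSeq β p.1 p.2)))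
    (hM.mono fun p hp => ?_) (fun f => ?_) (hK.tendsto_t.comp tendsto_fst)).congr' ?_
  · rw [LinearIsometryEquiv.norm_map]
    exact hp.2
  · simp only [resolventOp, adjoint_inverse]
    refine hst'.tendsto_inverse_apply (isUnit_adjoint hreg) (fun g => ?_) f
    have e : ∀ (z : ℂ) (A : L2 →L[ℂ] L2), adjoint (1 - z • A) g = g - conj z • adjoint A g := by
      intro z A
      rw [map_sub, map_smulₛₗ, ← star_eq_adjoint (1 : L2 →L[ℂ] L2), star_one]
      rfl
    have e' : ∀ n, adjoint (cutoff (τ n) * T) g = adjoint T (cutoff (τ n) g) := by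
      intro n
      rw [mul_def, adjoint_comp, adjoint_cutoff]
      rfl
    simp_rw [e, e']
    have h1 : Tendsto (fun n => adjoint T (cutoff (τ n) g)) atTop (𝓝 (adjoint T g)) :=
      ((adjoint T).continuous.tendsto g).comp (tendsto_cutoff_apply hK.tendsto g)
    have h2 := (Complex.continuous_conj.tendsto ζ).comp (tendsto_lamSeq hβ ζ)
    exact (h2.smul (h1.comp tendsto_fst)).const_sub g
  · filter_upwards [hM] with p hp
    rw [resolventKernel_eq (hK.isIntegralOperatorOf hT p.1) hp.1]
    rfl

/-- The resolvent kernels converge jointly in the index and the parameter. -/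
lemma tendsto_resolventKernel_kern (hK : IsParquet K T τ Ksub Ksub')
    (hT : IsIntegralOperatorOf T K) (hβ : Tendsto β atTop (𝓝 0))
    (hζ : ζ ∈ nablaS (shiftedSub β τ T)) :
    Tendsto (fun p : ℕ × ℂ => (resolventKernel (Ksub p.1) (lamSeq β p.1 p.2)).kern)
      (atTop ×ˢ 𝓝 ζ) (𝓝 (resolventKernel K ζ).kern) := by
  have hreg := ((mem_nablaS_shiftedSub_iff hβ hK.tendsto).1 hζ).2.2
  have h := (hK.tendsto_kern.comp tendsto_fst).add ((tendsto_lamSeq hβ ζ).smul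
    (tendsto_innerProd (hK.tendsto_t.comp tendsto_fst) (hK.tendsto_resolventKernel_t' hT hβ hζ)))
  rw [resolventKernel_eq hT hreg] at h ⊢
  refine h.congr' ?_
  filter_upwards [hK.eventually_mem_regularValues hβ hζ] with p hp
  rw [resolventKernel_eq (hK.isIntegralOperatorOf hT p.1) hp]
  rfl

end IsParquet

end Parquet

theorem mainTheorem1 (K : K0Kernel) (T : L2 →L[ℂ] L2) (hT : IsIntegralOperatorOf T K)
    (τ : ℕ → ℝ) (Ksub Ksub' : ℕ → K0Kernel) (hK : IsParquet K T τ Ksub Ksub')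
    (β : ℕ → ℂ) (hβ : Tendsto β atTop (𝓝 0)) :
    -- the inclusions
    (nablaS (shiftedSub β τ T)).Nonempty ∧
    nablaS (shiftedSub β τ T) ⊆ nablaS (shiftedSub' β τ T) ∧
    nablaS (shiftedSub' β τ T) ⊆ regularValues T ∧
    -- the numbers `λ_n(λ)` are eventually defined and tend to `λ`
    (∀ z : ℂ, (∀ᶠ n in atTop, 1 - β n * z ≠ 0) ∧
      Tendsto (fun n => lamSeq β n z) atTop (𝓝 z)) ∧
    -- the resolvent kernels below exist and are unique; those of the subkernels for all large `n`,
    -- uniformly on compact sets of `λ`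
    (∀ z ∈ nablaS (shiftedSub' β τ T), ∃! R, IsResolventKernel K z R) ∧
    (∀ C : Set ℂ, IsCompact C → C ⊆ nablaS (shiftedSub' β τ T) →
      ∀ᶠ n in atTop, ∀ z ∈ C, 1 - β n * z ≠ 0 ∧
        ∃! R, IsResolventKernel (Ksub n) (lamSeq β n z) R) ∧
    -- (a)
    (∀ z ∈ nablaS (shiftedSub' β τ T),
      Tendsto (fun n => ‖(resolventKernel (Ksub n) (lamSeq β n z)).t' - (resolventKernel K z).t'‖)
        atTop (𝓝 0)) ∧
    (∀ C : Set ℂ, IsCompact C → C ⊆ nablaS (shiftedSub' β τ T) → ∀ t : ℝ,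
      TendstoUniformlyOn (fun n z => (resolventKernel (Ksub n) (lamSeq β n z)).t' t)
        (fun z => (resolventKernel K z).t' t) atTop C) ∧
    -- (b)
    (∀ z ∈ nablaS (shiftedSub β τ T),
      Tendsto (fun n => ‖(resolventKernel (Ksub n) (lamSeq β n z)).t - (resolventKernel K z).t‖)
        atTop (𝓝 0)) ∧
    (∀ C : Set ℂ, IsCompact C → C ⊆ nablaS (shiftedSub β τ T) → ∀ s : ℝ,
      TendstoUniformlyOn (fun n z => (resolventKernel (Ksub n) (lamSeq β n z)).t s)
        (fun z => (resolventKernel K z).t s) atTop C) ∧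
    -- (c)
    (∀ z ∈ nablaS (shiftedSub' β τ T),
      Tendsto
        (fun n => ‖(resolventKernel (Ksub n) (lamSeq β n z)).kern - (resolventKernel K z).kern‖)
        atTop (𝓝 0)) ∧
    (∀ C : Set ℂ, IsCompact C → C ⊆ nablaS (shiftedSub' β τ T) → ∀ s t : ℝ,
      TendstoUniformlyOn (fun n z => (resolventKernel (Ksub n) (lamSeq β n z)).kern (s, t))
        (fun z => (resolventKernel K z).kern (s, t)) atTop C) := by
  have hτ := hK.tendsto
  rw [nablaS_shiftedSub' hβ hτ]
  have hreg : ∀ z ∈ nablaS (shiftedSub β τ T), z ∈ regularValues T := fun z hz =>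
    ((mem_nablaS_shiftedSub_iff hβ hτ).1 hz).2.2
  have hslice : ∀ z : ℂ, Tendsto (fun n : ℕ => (n, z)) atTop (atTop ×ˢ 𝓝 z) := fun z =>
    tendsto_id.prodMk tendsto_const_nhds
  refine ⟨nablaS_shiftedSub_nonempty hβ hτ, subset_rfl, hreg, fun z => ⟨?_, ?_⟩,
    fun z hz => existsUnique_isResolventKernel hT (hreg z hz), fun C hC hCs => ?_,
    fun z hz => ?_, fun C hC hCs t => ?_, fun z hz => ?_, fun C hC hCs s => ?_,
    fun z hz => ?_, fun C hC hCs s t => ?_⟩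
  · exact ((tendsto_one_sub_mul hβ z).comp (hslice z)).eventually_ne one_ne_zero
  · exact (tendsto_lamSeq hβ z).comp (hslice z)
  · have h : {p : ℕ × ℂ | 1 - β p.1 * p.2 ≠ 0 ∧
        lamSeq β p.1 p.2 ∈ regularValues (cutoff (τ p.1) * T)} ∈ atTop ×ˢ 𝓝ˢ C :=
      hC.mem_prod_nhdsSet_of_forall fun z hz =>
        ((tendsto_one_sub_mul hβ z).eventually_ne one_ne_zero).and
          (hK.eventually_mem_regularValues hβ (hCs hz))
    obtain ⟨p, hp, q, hq, hpq⟩ := eventually_prod_iff.1 h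
    filter_upwards [hp] with n hn z hz
    obtain ⟨h1, h2⟩ := hpq hn (hq.self_of_nhdsSet z hz)
    exact ⟨h1, existsUnique_isResolventKernel (hK.isIntegralOperatorOf hT n) h2⟩
  · exact tendsto_iff_norm_sub_tendsto_zero.1
      ((hK.tendsto_resolventKernel_t' hT hβ hz).comp (hslice z))
  · exact tendstoUniformlyOn_of_tendsto_prod_nhds hC fun z hz =>
      tendsto_apply (hK.tendsto_resolventKernel_t' hT hβ (hCs hz)) t
  · exact tendsto_iff_norm_sub_tendsto_zero.1
      ((hK.tendsto_resolventKernel_t hT hβ hz).comp (hslice z))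
  · exact tendstoUniformlyOn_of_tendsto_prod_nhds hC fun z hz =>
      tendsto_apply (hK.tendsto_resolventKernel_t hT hβ (hCs hz)) s
  · exact tendsto_iff_norm_sub_tendsto_zero.1
      ((hK.tendsto_resolventKernel_kern hT hβ hz).comp (hslice z))
  · exact tendstoUniformlyOn_of_tendsto_prod_nhds hC fun z hz =>
      tendsto_apply (hK.tendsto_resolventKernel_kern hT hβ (hCs hz)) (s, t)
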